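/- Let $\mathcal P$ be a finite ranked lattice of rank $r$, with least element $\hat 0$, greatest element $\hat 1$ and rank function $\mathrm{rk}$ ($\mathrm{rk}\,\hat 0=0$, $\mathrm{rk}\,y=\mathrm{rk}\,x+1$ whenever $y$ covers $x$, $r=\mathrm{rk}\,\hat 1$). **Kazhdan–Lusztig polynomial.** For $F\in\mathcal P$ put $\mathcal P^F=\{E : E\ge F\}$ and $\mathcal P_F=\{E : E\le F\}$. For a finite ranked lattice $\mathcal Q$ let $\chi(\mathcal Q,t)=\sum_{E\in \mathcal Q}\mu(\hat 0,E)\,t^{\mathrm{rk}\,\mathcal Q-\mathrm{rk}\,E}$ be its characteristic polynomial. The Kazhdan–Lusztig polynomials $P(\mathcal Q,t)\in\mathbb Z[t]$ of finite ranked lattices $\mathcal Q$ are the unique polynomials defined recursively by: $P(\mathcal Q,t)=1$ if $\mathrm{rk}\,\mathcal Q=0$; $\deg P(\mathcal Q,t)<\tfrac12\mathrm{rk}\,\mathcal Q$ if $\mathrm{rk}\,\mathcal Q>0$; and, for all $\mathcal Q$, $$t^{\mathrm{rk}\,\mathcal Q}P(\mathcal Q,t^{-1})=\sum_{F\in\mathcal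 Q}\chi(\mathcal Q_F,t)\,P(\mathcal Q^F,t).$$ **Whitney numbers.** For integers $i_1<\dots<i_m$, $W_{\{i_1,\dots,i_m\}}(\mathcal P)$ is the number of tuples $X_1\le\dots\le X_m$ in $\mathcal P$ with $\mathrm{rk}\,X_j=i_j$ for all $j$. For a finite set $I\subset\mathbb Z[r]$ of polynomials in a formal variable $r$, $W_I(\mathcal P)$ is obtained by substituting $r=\mathrm{rk}\,\mathcal P$ in the elements of $I$. **Index sets.** For $t\ge1$ let $A_t=\{I\subseteq\{1,\dots,t\} : t\in I\}$, and let $A_0=\{\emptyset\}$. For a finite $I\subset\mathbb Z[r]$ let $F_s(I)=\{p(s)+r-s : p\in I\}$. Define $S_1=\{\{1\}\}$ and, for $k>1$, $$S_k=A_k\cup\bigcup_{s=3}^{2k-1}\ \bigcup_{\max\{1,s-k\}\le i<s/2}T_k^s(i),\qquad T_k^s(i)=\big\{\alpha\sqcup\{r-s\}\sqcup F_s(\beta) : \alpha\in A_{k-s+i},\ \beta\in S_i\big\}.$$ **Signs.** For $I\in A_k$ let $s_k(I)=|I|-1$; for $I=\alpha\sqcup\{r-s\}\sqcup F_s(\beta)\in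 T_k^s(i)$ (with $\alpha\in A_{k-s+i}$, $\beta\in S_i$) let $s_k(I)=|\alpha|+s_i(\beta)$. **Top-heavy partner.** For $I\subset\mathbb Z[r]$ let $\min^r(I)=\min\{n\in\mathbb Z : r-n\in I\}$. For $I\in A_k$ let $d(I)=k$ if $I=\{k\}$ and $d(I)=k-\max(I\setminus\{k\})$ otherwise, and let $t(I)=(I\setminus\{k\})\cup\{r-d(I)\}$. For $I\in S_k\setminus A_k$ let $d(I)=\min^r\big(I\setminus\{r-\min^r(I)\}\big)-\min^r(I)$ and $t(I)=\big(I\setminus\{r-\min^r(I)\}\big)\cup\{r-d(I)\}$. **Theorem.** For every integer $k$ with $1\le k<r/2$, the coefficient of $t^k$ in $P(\mathcal P,t)$ equals $$\sum_{I\in S_k}(-1)^{s_k(I)}\big(W_{t(I)}(\mathcal P)-W_I(\mathcal P)\big).$$ -/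

import Mathlib

open Polynomial

namespace KLWhitney

/-! ### Kazhdan–Lusztig polynomials -/

section Rank

variable {P : Type*} [PartialOrder P] [GradeMinOrder ℕ P]

/-- The rank of the interval `[a, b]` (for `a ≤ b`). -/
def intervalRank (a b : P) : ℕ := grade ℕ b - grade ℕ a

theorem intervalRank_add {a b c : P} (hab : a ≤ b) (hbc : b ≤ c) :
    intervalRank a b + intervalRank b c = intervalRank a c := by
  have h1 : grade ℕ a ≤ grade ℕ b := grade_mono hab
  have h2 : grade ℕ b ≤ grade ℕ c := grade_mono hbc
  unfold intervalRank
  omega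

theorem intervalRank_pos {a b : P} (hab : a < b) : 0 < intervalRank a b := by
  have h1 : grade ℕ a < grade ℕ b := grade_strictMono hab
  unfold intervalRank
  omega

end Rank

section Poset

variable {P : Type*} [PartialOrder P] [BoundedOrder P] [LocallyFiniteOrder P] [DecidableEq P]
  [GradeMinOrder ℕ P]

/-- The (usual) characteristic polynomial of the interval `[a, b]`:
`∑_{E ∈ [a, b]} μ(a, E) t ^ (rk b - rk E)`. -/
noncomputable def charPoly (a b : P) : ℤ[X] :=
  ∑ E ∈ Finset.Icc a b, C (IncidenceAlgebra.mu ℤ a E) * X ^ intervalRank E b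

/-- The defining conditions of Kazhdan–Lusztig polynomials, for all the upper intervals of `P` at
once: `f a` is the polynomial of the restriction `{E | a ≤ E} = [a, ⊤]`. In the recursion at `a`,
the localization of `[a, ⊤]` at `F` is `[a, F]`, and its restriction to `F` is `[F, ⊤]`.
Given the degree bound, `reflect n p` is `t ^ n * p (t⁻¹)`. -/
structure IsKLFamily (f : P → ℤ[X]) : Prop where
  rank_zero : ∀ a, intervalRank a ⊤ = 0 → f a = 1
  degree_lt : ∀ a, 0 < intervalRank a ⊤ → 2 * (f a).natDegree < intervalRank a ⊤
  recursion : ∀ a, (f a).reflect (intervalRank a ⊤) =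
    ∑ F ∈ Finset.Icc a ⊤, charPoly a F * f F

theorem charPoly_self (a : P) : charPoly a a = 1 := by
  simp [charPoly, intervalRank]

theorem reflect_sum' {ι : Type*} (n : ℕ) (s : Finset ι) (g : ι → ℤ[X]) :
    (∑ i ∈ s, g i).reflect n = ∑ i ∈ s, (g i).reflect n := by
  classical
  induction s using Finset.induction_on with
  | empty => simp
  | insert i s hi ih => rw [Finset.sum_insert hi, Finset.sum_insert hi, reflect_add, ih]

theorem natDegree_charPoly_le (a b : P) : (charPoly a b).natDegree ≤ intervalRank a b := by
  refine natDegree_sum_le_of_forall_le _ _ fun E hE => ?_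
  rw [Finset.mem_Icc] at hE
  refine (natDegree_C_mul_X_pow_le _ _).trans ?_
  have := intervalRank_add hE.1 hE.2
  omega

theorem reflect_charPoly (a b : P) : (charPoly a b).reflect (intervalRank a b) =
    ∑ E ∈ Finset.Icc a b, C (IncidenceAlgebra.mu ℤ a E) * X ^ intervalRank a E := by
  rw [charPoly, reflect_sum']
  refine Finset.sum_congr rfl fun E hE => ?_
  rw [Finset.mem_Icc] at hE
  have := intervalRank_add hE.1 hE.2
  rw [reflect_C_mul_X_pow, revAt_le (by omega)]
  congr 2
  omega

/-- The characteristic polynomials form a kernel. -/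
theorem charPoly_kernel (a b : P) :
    ∑ F ∈ Finset.Icc a b, (charPoly a F).reflect (intervalRank a F) * charPoly F b =
      if a = b then 1 else 0 := by
  have hinv : ∀ E E' : P, ∑ F ∈ Finset.Icc E E', C (IncidenceAlgebra.mu ℤ F E') =
      if E = E' then (1 : ℤ[X]) else 0 := by
    intro E E'
    rw [← map_sum, IncidenceAlgebra.sum_Icc_mu_left]
    split_ifs <;> simp
  have hinv' : ∀ E E' : P, ∑ F ∈ Finset.Icc E E', C (IncidenceAlgebra.mu ℤ E F) =
      if E = E' then (1 : ℤ[X]) else 0 := by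
    intro E E'
    rw [← map_sum, IncidenceAlgebra.sum_Icc_mu_right]
    split_ifs <;> simp
  calc ∑ F ∈ Finset.Icc a b, (charPoly a F).reflect (intervalRank a F) * charPoly F b
      = ∑ F ∈ Finset.Icc a b, ∑ E ∈ Finset.Icc a F, ∑ E' ∈ Finset.Icc F b,
          (C (IncidenceAlgebra.mu ℤ a E) * X ^ intervalRank a E) *
          (C (IncidenceAlgebra.mu ℤ F E') * X ^ intervalRank E' b) := by
        refine Finset.sum_congr rfl fun F _ => ?_
        rw [reflect_charPoly, charPoly, Finset.sum_mul_sum]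
    _ = ∑ E ∈ Finset.Icc a b, ∑ F ∈ Finset.Icc E b, ∑ E' ∈ Finset.Icc F b,
          (C (IncidenceAlgebra.mu ℤ a E) * X ^ intervalRank a E) *
          (C (IncidenceAlgebra.mu ℤ F E') * X ^ intervalRank E' b) := by
        refine Finset.sum_comm' fun x y => ?_
        simp only [Finset.mem_Icc]
        constructor
        · rintro ⟨⟨h1, h2⟩, h3, h4⟩
          exact ⟨⟨h4, h2⟩, h3, h4.trans h2⟩
        · rintro ⟨⟨h1, h2⟩, h3, h4⟩
          exact ⟨⟨h3.trans h1, h2⟩, h3, h1⟩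
    _ = ∑ E ∈ Finset.Icc a b, ∑ E' ∈ Finset.Icc E b, ∑ F ∈ Finset.Icc E E',
          (C (IncidenceAlgebra.mu ℤ a E) * X ^ intervalRank a E) *
          (C (IncidenceAlgebra.mu ℤ F E') * X ^ intervalRank E' b) := by
        refine Finset.sum_congr rfl fun E _ => ?_
        refine Finset.sum_comm' fun x y => ?_
        simp only [Finset.mem_Icc]
        constructor
        · rintro ⟨⟨h1, h2⟩, h3, h4⟩
          exact ⟨⟨h1, h3⟩, h1.trans h3, h4⟩
        · rintro ⟨⟨h1, h2⟩, h3, h4⟩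
          exact ⟨⟨h1, h2.trans h4⟩, h2, h4⟩
    _ = ∑ E ∈ Finset.Icc a b, ∑ E' ∈ Finset.Icc E b,
          if E = E' then (C (IncidenceAlgebra.mu ℤ a E) * X ^ intervalRank a E) *
            X ^ intervalRank E' b else 0 := by
        refine Finset.sum_congr rfl fun E _ => Finset.sum_congr rfl fun E' _ => ?_
        rw [← Finset.mul_sum, ← Finset.sum_mul, hinv]
        split_ifs <;> simp
    _ = ∑ E ∈ Finset.Icc a b, C (IncidenceAlgebra.mu ℤ a E) * X ^ intervalRank a b := by
        refine Finset.sum_congr rfl fun E hE => ?_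
        rw [Finset.mem_Icc] at hE
        rw [Finset.sum_ite_eq, if_pos (Finset.mem_Icc.2 ⟨le_rfl, hE.2⟩), mul_assoc, ← pow_add,
          intervalRank_add hE.1 hE.2]
    _ = if a = b then 1 else 0 := by
        rw [← Finset.sum_mul, hinv']
        split_ifs with h
        · subst h; simp [intervalRank]
        · simp

/-- Explicit recursive solution of the defining conditions. -/
noncomputable def klAux (a : P) : ℤ[X] :=
  if intervalRank a ⊤ = 0 then 1 else
    ∑ k ∈ (Finset.range (intervalRank a ⊤)).filter (fun k => 2 * k < intervalRank a ⊤),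
      C ((∑ F : {F : P // F ∈ Finset.Ioc a ⊤}, charPoly a F.1 * klAux F.1).coeff
        (intervalRank a ⊤ - k)) * X ^ k
termination_by intervalRank a ⊤
decreasing_by
  have hF := Finset.mem_Ioc.1 F.2
  have h1 := intervalRank_add hF.1.le hF.2
  have h2 := intervalRank_pos hF.1
  omega

theorem coeff_klAux (a : P) (ha : intervalRank a ⊤ ≠ 0) (j : ℕ) : (klAux a).coeff j =
    if 2 * j < intervalRank a ⊤ then
      (∑ F ∈ Finset.Ioc a ⊤, charPoly a F * klAux F).coeff (intervalRank a ⊤ - j) else 0 := by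
  rw [klAux, if_neg ha, Finset.sum_coe_sort (Finset.Ioc a ⊤) (fun F => charPoly a F * klAux F),
    finsetSum_coeff]
  simp only [coeff_C_mul_X_pow]
  rw [Finset.sum_ite_eq]
  refine if_congr ?_ rfl rfl
  simp only [Finset.mem_filter, Finset.mem_range]
  omega

theorem two_mul_natDegree_klAux (a : P) (ha : intervalRank a ⊤ ≠ 0) :
    2 * (klAux a).natDegree < intervalRank a ⊤ := by
  by_cases h0 : klAux a = 0
  · rw [h0]; simp; omega
  · have h1 : (klAux a).coeff (klAux a).natDegree ≠ 0 := by simpa using h0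
    rw [coeff_klAux a ha] at h1
    by_contra h
    simp [h] at h1

theorem natDegree_klAux_le (a : P) : (klAux a).natDegree ≤ intervalRank a ⊤ := by
  by_cases ha : intervalRank a ⊤ = 0
  · rw [klAux, if_pos ha]; simp
  · have := two_mul_natDegree_klAux a ha
    omega

theorem sum_Icc_eq (a : P) (g : P → ℤ[X]) :
    ∑ F ∈ Finset.Icc a ⊤, charPoly a F * g F =
      g a + ∑ F ∈ Finset.Ioc a ⊤, charPoly a F * g F := by
  rw [← Finset.Ioc_insert_left (le_top : a ≤ ⊤), Finset.sum_insert (by simp), charPoly_self,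
    one_mul]

theorem klAux_recursion (a : P) : (klAux a).reflect (intervalRank a ⊤) =
    ∑ F ∈ Finset.Icc a ⊤, charPoly a F * klAux F := by
  induction hn : intervalRank a ⊤ using Nat.strong_induction_on generalizing a with
  | _ n ih =>
  by_cases h0 : n = 0
  · have hat : a = ⊤ := by
      by_contra h
      have := intervalRank_pos (lt_of_le_of_ne le_top h)
      omega
    subst hat
    have h1 : klAux (⊤ : P) = 1 := by rw [klAux, if_pos (hn.trans h0)]
    simp [h0, h1, charPoly_self]
  have ih' : ∀ F ∈ Finset.Ioc a (⊤ : P), (klAux F).reflect (intervalRank F ⊤) =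
      ∑ G ∈ Finset.Icc F ⊤, charPoly F G * klAux G := by
    intro F hF
    rw [Finset.mem_Ioc] at hF
    have h1 := intervalRank_add hF.1.le hF.2
    have h2 := intervalRank_pos hF.1
    exact ih _ (by omega) F rfl
  set R : ℤ[X] := ∑ F ∈ Finset.Ioc a ⊤, charPoly a F * klAux F with hR
  have hdeg : R.natDegree ≤ n := by
    refine natDegree_sum_le_of_forall_le _ _ fun F hF => ?_
    rw [Finset.mem_Ioc] at hF
    have h1 := intervalRank_add hF.1.le hF.2
    refine natDegree_mul_le.trans ?_
    have h2 := natDegree_charPoly_le a F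
    have h3 := natDegree_klAux_le F
    omega
  have hanti : R.reflect n = -R := by
    calc R.reflect n = ∑ F ∈ Finset.Ioc a ⊤, (charPoly a F).reflect (intervalRank a F) *
          (klAux F).reflect (intervalRank F ⊤) := by
          rw [hR, reflect_sum']
          refine Finset.sum_congr rfl fun F hF => ?_
          rw [Finset.mem_Ioc] at hF
          rw [← hn, ← intervalRank_add hF.1.le hF.2]
          exact reflect_mul _ _ (natDegree_charPoly_le a F) (natDegree_klAux_le F)
      _ = ∑ F ∈ Finset.Ioc a ⊤, ∑ G ∈ Finset.Icc F ⊤,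
          (charPoly a F).reflect (intervalRank a F) * charPoly F G * klAux G := by
          refine Finset.sum_congr rfl fun F hF => ?_
          rw [ih' F hF, Finset.mul_sum]
          exact Finset.sum_congr rfl fun G _ => (mul_assoc _ _ _).symm
      _ = ∑ G ∈ Finset.Ioc a ⊤, ∑ F ∈ Finset.Ioc a G,
          (charPoly a F).reflect (intervalRank a F) * charPoly F G * klAux G := by
          refine Finset.sum_comm' fun x y => ?_
          simp only [Finset.mem_Ioc, Finset.mem_Icc]
          constructor
          · rintro ⟨⟨h1, h2⟩, h3, h4⟩
            exact ⟨⟨h1, h3⟩, h1.trans_le h3, h4⟩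
          · rintro ⟨⟨h1, h2⟩, h3, h4⟩
            exact ⟨⟨h1, h2.trans h4⟩, h2, h4⟩
      _ = ∑ G ∈ Finset.Ioc a ⊤, -(charPoly a G * klAux G) := by
          refine Finset.sum_congr rfl fun G hG => ?_
          rw [Finset.mem_Ioc] at hG
          have hk := charPoly_kernel a G
          rw [if_neg hG.1.ne, ← Finset.Ioc_insert_left hG.1.le, Finset.sum_insert (by simp),
            charPoly_self] at hk
          rw [← Finset.sum_mul, eq_neg_of_add_eq_zero_right hk]
          simp [intervalRank]
      _ = -R := by rw [Finset.sum_neg_distrib]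
  rw [sum_Icc_eq, ← hR]
  have hcoeff : ∀ j, (klAux a).coeff j = if 2 * j < n then R.coeff (n - j) else 0 := by
    intro j
    rw [coeff_klAux a (by omega), hn]
  have hRc : ∀ j, j ≤ n → R.coeff (n - j) = - R.coeff j := by
    intro j hj
    have := congrArg (fun p => p.coeff j) hanti
    simpa [coeff_reflect, revAt_le hj] using this
  ext j
  rw [coeff_reflect, coeff_add]
  rcases le_or_gt j n with hj | hj
  · rw [revAt_le hj, hcoeff, hcoeff]
    have hc := hRc j hj
    have hjj : n - (n - j) = j := by omega
    rw [hjj]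
    split_ifs with h1 h2 h2
    · omega
    · simp
    · rw [hc]; simp
    · have : n - j = j := by omega
      rw [this] at hc
      omega
  · rw [revAt_eq_self_of_lt hj, hcoeff, if_neg (by omega), coeff_eq_zero_of_natDegree_lt (by omega)]
    simp

theorem isKLFamily_klAux : IsKLFamily (klAux : P → ℤ[X]) where
  rank_zero a ha := by rw [klAux, if_pos ha]
  degree_lt a ha := two_mul_natDegree_klAux a (by omega)
  recursion := klAux_recursion

theorem IsKLFamily.unique {f g : P → ℤ[X]} (hf : IsKLFamily f) (hg : IsKLFamily g) : f = g := by
  funext a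
  induction hn : intervalRank a ⊤ using Nat.strong_induction_on generalizing a with
  | _ n ih =>
  by_cases h0 : n = 0
  · rw [hf.rank_zero a (by omega), hg.rank_zero a (by omega)]
  have h1 := hf.recursion a
  have h2 := hg.recursion a
  have h3 : ∑ F ∈ Finset.Ioc a ⊤, charPoly a F * f F =
      ∑ F ∈ Finset.Ioc a ⊤, charPoly a F * g F := by
    refine Finset.sum_congr rfl fun F hF => ?_
    rw [Finset.mem_Ioc] at hF
    have h1 := intervalRank_add hF.1.le hF.2
    have h2 := intervalRank_pos hF.1
    rw [ih _ (by omega) F rfl]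
  have hdf := hf.degree_lt a (by omega)
  have hdg := hg.degree_lt a (by omega)
  rw [sum_Icc_eq] at h1 h2
  rw [h3] at h1
  ext j
  rcases lt_or_ge (2 * j) n with hj | hj
  · have e1 := congrArg (fun p => p.coeff (n - j)) h1
    have e2 := congrArg (fun p => p.coeff (n - j)) h2
    simp only [coeff_reflect, hn, revAt_le (Nat.sub_le n j), coeff_add] at e1 e2
    rw [coeff_eq_zero_of_natDegree_lt (p := f a) (n := n - j) (by omega)] at e1
    rw [coeff_eq_zero_of_natDegree_lt (p := g a) (n := n - j) (by omega)] at e2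
    have hjj : n - (n - j) = j := by omega
    rw [hjj] at e1 e2
    rw [e1, e2]
  · rw [coeff_eq_zero_of_natDegree_lt (by omega), coeff_eq_zero_of_natDegree_lt (by omega)]

theorem existsUnique_isKLFamily : ∃! f : P → ℤ[X], IsKLFamily f :=
  ⟨klAux, isKLFamily_klAux, fun _ hg => hg.unique isKLFamily_klAux⟩

variable (P) in
/-- The Kazhdan–Lusztig polynomial of `P = [⊥, ⊤]`. -/
noncomputable def klPolynomial : ℤ[X] :=
  Classical.choose (existsUnique_isKLFamily (P := P)).exists ⊥

/-- The multi-indexed Whitney number of the second kind `W_{(i_1, …, i_n)}(P)`: the sum of `1` over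
all `X_1 ≤ ⋯ ≤ X_n` in `P` with `rk X_j = i_j`. -/
noncomputable def whitney (P : Type*) [PartialOrder P] [GradeMinOrder ℕ P] {n : ℕ}
    (i : Fin n → ℤ) : ℕ :=
  Nat.card {x : Fin n → P // Monotone x ∧ ∀ j, (grade ℕ (x j) : ℤ) = i j}

/-- `W_I(P)` for a finite set `I` of polynomials in the variable `r`: put `r = rk P` and list the
resulting set of integers in increasing order. -/
noncomputable def whitneySet (P : Type*) [PartialOrder P] [BoundedOrder P] [GradeMinOrder ℕ P]
    (I : Finset ℤ[X]) : ℕ :=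
  whitney P ((I.image (eval (grade ℕ (⊤ : P) : ℤ))).orderEmbOfFin rfl)

end Poset

/-! ### The index sets. The variable `X` of `ℤ[X]` plays the role of `r`. -/

/-- For `t ≥ 1`, the subsets of `{1, …, t}` that contain `t`; `indexA 0 = {∅}`. -/
noncomputable def indexA (t : ℕ) : Finset (Finset ℤ[X]) :=
  if t = 0 then {∅} else
    ((Finset.Icc 1 t).powerset.filter (fun I => t ∈ I)).image
      (fun I => I.image (fun n : ℕ => C (n : ℤ)))

/-- `F_s(I) = {p(s) + r - s | p ∈ I}`. -/
noncomputable def shiftF (s : ℕ) (I : Finset ℤ[X]) : Finset ℤ[X] :=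
  I.image (fun p => C (p.eval (s : ℤ)) + X - C (s : ℤ))

/-- `α ⊔ {r - s} ⊔ F_s(β)`. -/
noncomputable def glue (s : ℕ) (α β : Finset ℤ[X]) : Finset ℤ[X] :=
  α ∪ {X - C (s : ℤ)} ∪ shiftF s β

/-- The range of the pairs `(s, i)` in the recursion: `3 ≤ s ≤ 2k - 1`, `max {1, s - k} ≤ i < s/2`
(these imply `i < k`). -/
def Admissible (k s i : ℕ) : Prop :=
  3 ≤ s ∧ s ≤ 2 * k - 1 ∧ max 1 (s - k) ≤ i ∧ 2 * i < s

instance (k s i : ℕ) : Decidable (Admissible k s i) := by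
  unfold Admissible; infer_instance

/-- The index set `S_k` (for `k ≥ 1`). -/
noncomputable def indexS (k : ℕ) : Finset (Finset ℤ[X]) :=
  indexA k ∪ (Finset.Icc 3 (2 * k - 1)).biUnion fun s =>
    ((Finset.univ : Finset (Fin k)).filter fun i : Fin k => Admissible k s i).biUnion fun i =>
      Finset.image₂ (glue s) (indexA (k + i - s)) (indexS i)
termination_by k
decreasing_by exact i.2

open Classical in
/-- The exponent `s_k(I)` of the sign: `|I| - 1` if `I ∈ A_k`, and `|α| + s_i(β)` if
`I = α ⊔ {r - s} ⊔ F_s(β)` with `α ∈ A_{k-s+i}` and `β ∈ S_i`. -/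
noncomputable def signExp (k : ℕ) (I : Finset ℤ[X]) : ℕ :=
  if I ∈ indexA k then I.card - 1
  else if h : ∃ d : ℕ × Fin k × Finset ℤ[X] × Finset ℤ[X],
      Admissible k d.1 d.2.1 ∧ d.2.2.1 ∈ indexA (k + d.2.1 - d.1) ∧ d.2.2.2 ∈ indexS d.2.1 ∧
        I = glue d.1 d.2.2.1 d.2.2.2 then
    h.choose.2.2.1.card + signExp h.choose.2.1 h.choose.2.2.2
  else 0
termination_by k
decreasing_by exact h.choose.2.1.2

/-- `min^r(I) = min {n ∈ ℤ | r - n ∈ I}`. -/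
noncomputable def minR (I : Finset ℤ[X]) : ℤ := sInf {n : ℤ | X - C n ∈ I}

/-- The largest integer in `I`. -/
noncomputable def maxInt (I : Finset ℤ[X]) : ℤ := sSup {n : ℤ | C n ∈ I}

open Classical in
/-- The shift `d(I)`. -/
noncomputable def shiftD (k : ℕ) (I : Finset ℤ[X]) : ℤ :=
  if I ∈ indexA k then
    if I = {C (k : ℤ)} then k else k - maxInt (I \ {C (k : ℤ)})
  else minR (I \ {X - C (minR I)}) - minR I

open Classical in
/-- The top-heavy partner `t(I)` of `I ∈ S_k`. -/
noncomputable def partner (k : ℕ) (I : Finset ℤ[X]) : Finset ℤ[X] :=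
  if I ∈ indexA k then I \ {C (k : ℤ)} ∪ {X - C (shiftD k I)}
  else I \ {X - C (minR I)} ∪ {X - C (shiftD k I)}

end KLWhitney

namespace KLWhitney

/-! ### Palindromicity of the Z-polynomial and the coefficient recursion -/

section Recursion

set_option linter.unusedSectionVars false

variable {P : Type*} [PartialOrder P] [BoundedOrder P] [LocallyFiniteOrder P] [DecidableEq P]
  [GradeMinOrder ℕ P]

/-! The Z-polynomial `∑ F, t ^ rk [a, F] * f F` is palindromic (`IsKLFamily.reflect_zPoly`):
reversing it, applying the Kazhdan–Lusztig recursion to every term and exchanging sums leaves sums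
of characteristic polynomials over lower endpoints, which Möbius inversion collapses to monomials.

Write the rank as `k + D` with `k < D`. Equating the coefficients of `t ^ k` and `t ^ D` expresses
the `k`-th coefficient at `a` as a sum over `i < k` of `i`-th coefficients: with sign `+` at
elements of corank `i + k`, with sign `-` at elements of corank `i + D`
(`IsKLFamily.coeff_recursion`). Each is a problem of the same kind, the pair `(k, D)` being replaced
by `(i, k)` or `(i, D)`; at `i = 0` the coefficient is `1`. Unrolling gives a signed sum over words
(`KLPath`) of differences of two multichain counts, whose corank lists differ only in the last
entry: `k` against `D` for the final pair (`IsKLFamily.coeff_eq_sum_paths`).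

It remains to match words with `indexS k`. Coranks before the first jump have the form `j + D`,
hence constant rank `k - j`; later ones do not involve `D` and give the ranks `r - n`. The first
jump supplies the element `r - s`, and the word after it supplies `β`. Under this bijection
(`KLPath.sum_indexS`) signs and partners agree (`KLPath.signExp_toFinset`,
`KLPath.partner_toFinset`). -/

theorem sum_Icc_charPoly_left {a b : P} (hab : a ≤ b) :
    ∑ F ∈ Finset.Icc a b, charPoly F b = X ^ intervalRank a b := by
  calc ∑ F ∈ Finset.Icc a b, charPoly F b
      = ∑ E ∈ Finset.Icc a b, ∑ F ∈ Finset.Icc a E,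
          C (IncidenceAlgebra.mu ℤ F E) * X ^ intervalRank E b := by
        simp only [charPoly]
        refine Finset.sum_comm' fun x y => ?_
        simp only [Finset.mem_Icc]
        constructor
        · rintro ⟨⟨h1, h2⟩, h3, h4⟩
          exact ⟨⟨h1, h3⟩, h1.trans h3, h4⟩
        · rintro ⟨⟨h1, h2⟩, h3, h4⟩
          exact ⟨⟨h1, h2.trans h4⟩, h2, h4⟩
    _ = ∑ E ∈ Finset.Icc a b, if a = E then X ^ intervalRank E b else 0 := by
        refine Finset.sum_congr rfl fun E _ => ?_
        rw [← Finset.sum_mul, ← map_sum, IncidenceAlgebra.sum_Icc_mu_left]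
        split_ifs <;> simp
    _ = _ := by
        rw [Finset.sum_ite_eq, if_pos (Finset.mem_Icc.2 ⟨le_rfl, hab⟩)]

/-- The Z-polynomial of the upper interval `[a, ⊤]`. -/
noncomputable def zPoly (f : P → ℤ[X]) (a : P) : ℤ[X] :=
  ∑ F ∈ Finset.Icc a ⊤, X ^ intervalRank a F * f F

variable {f : P → ℤ[X]}

theorem IsKLFamily.natDegree_le (hf : IsKLFamily f) (a : P) :
    (f a).natDegree ≤ intervalRank a ⊤ := by
  rcases Nat.eq_zero_or_pos (intervalRank a ⊤) with h | h
  · simp [hf.rank_zero a h]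
  · have := hf.degree_lt a h
    omega

theorem IsKLFamily.reflect_zPoly (hf : IsKLFamily f) (a : P) :
    (zPoly f a).reflect (intervalRank a ⊤) = zPoly f a := by
  calc (zPoly f a).reflect (intervalRank a ⊤)
      = ∑ F ∈ Finset.Icc a ⊤, (f F).reflect (intervalRank F ⊤) := by
        rw [zPoly, reflect_sum']
        refine Finset.sum_congr rfl fun F hF => ?_
        rw [Finset.mem_Icc] at hF
        rw [← intervalRank_add hF.1 hF.2,
          reflect_mul _ _ (natDegree_X_pow_le _) (hf.natDegree_le F)]
        have : (X ^ intervalRank a F : ℤ[X]).reflect (intervalRank a F) = 1 := by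
          rw [← one_mul (X ^ _), ← C_1, reflect_C_mul_X_pow, revAt_le le_rfl]
          simp
        rw [this, one_mul]
    _ = ∑ F ∈ Finset.Icc a ⊤, ∑ G ∈ Finset.Icc F ⊤, charPoly F G * f G :=
        Finset.sum_congr rfl fun F _ => hf.recursion F
    _ = ∑ G ∈ Finset.Icc a ⊤, ∑ F ∈ Finset.Icc a G, charPoly F G * f G := by
        refine Finset.sum_comm' fun x y => ?_
        simp only [Finset.mem_Icc]
        constructor
        · rintro ⟨⟨h1, h2⟩, h3, h4⟩
          exact ⟨⟨h1, h3⟩, h1.trans h3, h4⟩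
        · rintro ⟨⟨h1, h2⟩, h3, h4⟩
          exact ⟨⟨h1, h2.trans h4⟩, h2, h4⟩
    _ = zPoly f a := by
        refine Finset.sum_congr rfl fun G hG => ?_
        rw [← Finset.sum_mul, sum_Icc_charPoly_left (Finset.mem_Icc.1 hG).1]

theorem coeff_zPoly (f : P → ℤ[X]) (a : P) (k : ℕ) : (zPoly f a).coeff k =
    ∑ F ∈ Finset.Icc a ⊤,
      if intervalRank a F ≤ k then (f F).coeff (k - intervalRank a F) else 0 := by
  simp only [zPoly, finsetSum_coeff, coeff_X_pow_mul']

/-- Palindromicity allows reading off the complementary coefficient instead; there the index at `F`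
depends only on the corank of `F`. -/
theorem IsKLFamily.coeff_zPoly_eq (hf : IsKLFamily f) (a : P) {k : ℕ}
    (hk : k ≤ intervalRank a ⊤) : (zPoly f a).coeff k =
      ∑ F ∈ Finset.Icc a ⊤,
        if k ≤ intervalRank F ⊤ then (f F).coeff (intervalRank F ⊤ - k) else 0 := by
  rw [← hf.reflect_zPoly a, coeff_reflect, revAt_le hk, coeff_zPoly]
  refine Finset.sum_congr rfl fun F hF => ?_
  rw [Finset.mem_Icc] at hF
  have := intervalRank_add hF.1 hF.2
  have h2 : intervalRank a ⊤ - k - intervalRank a F = intervalRank F ⊤ - k := by omega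
  rw [h2]
  exact if_congr (by omega) rfl rfl

/-- In the constant term of the Z-polynomial only `F = a` survives; in its leading term the degree
bound leaves only `F = ⊤`. -/
theorem IsKLFamily.coeff_zero (hf : IsKLFamily f) (a : P) : (f a).coeff 0 = 1 := by
  have h1 := hf.coeff_zPoly_eq a (Nat.zero_le _)
  rw [coeff_zPoly, Finset.sum_eq_single a, Finset.sum_eq_single ⊤] at h1
  · have h0 : intervalRank (⊤ : P) ⊤ = 0 := by simp [intervalRank]
    have h0' : intervalRank a a = 0 := by simp [intervalRank]
    simpa [h0, h0', hf.rank_zero ⊤ h0] using h1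
  · intro F hF hne
    have hpos := intervalRank_pos (lt_of_le_of_ne le_top hne)
    have := hf.degree_lt F hpos
    rw [if_pos (Nat.zero_le _), coeff_eq_zero_of_natDegree_lt (by omega)]
  · intro h; exact absurd (Finset.mem_Icc.2 ⟨le_top, le_rfl⟩) h
  · intro F hF hne
    have hpos := intervalRank_pos (lt_of_le_of_ne (Finset.mem_Icc.1 hF).1 hne.symm)
    rw [if_neg (by omega)]
  · intro h; exact absurd (Finset.mem_Icc.2 ⟨le_rfl, le_top⟩) h

/-- The sum of `g` over the elements of corank `n` above `a`. -/
def levelSum (n : ℕ) (g : P → ℤ) (a : P) : ℤ :=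
  ∑ F ∈ (Finset.Icc a ⊤).filter (fun F => intervalRank F ⊤ = n), g F

theorem sum_levelSum (s : Finset ℕ) (c : ℕ → ℕ) (g : ℕ → P → ℤ) (a : P) :
    ∑ j ∈ s, levelSum (c j) (g j) a =
      ∑ F ∈ Finset.Icc a ⊤, ∑ j ∈ s, if intervalRank F ⊤ = c j then g j F else 0 := by
  simp only [levelSum, Finset.sum_filter]
  exact Finset.sum_comm

/-- Comparison of the coefficients of `t ^ k` and `t ^ (rk - k)` of the Z-polynomial. -/
theorem IsKLFamily.coeff_recursion (hf : IsKLFamily f) {k D : ℕ} (hk : 0 < k) (hD : k < D)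
    (a : P) (ha : intervalRank a ⊤ = k + D) :
    (f a).coeff k = ∑ i ∈ Finset.range k, (levelSum (i + k) (fun F => (f F).coeff i) a -
      levelSum (i + D) (fun F => (f F).coeff i) a) := by
  have h1 := hf.coeff_zPoly_eq a (k := k) (by omega)
  -- For given `F` and `c` at most one `i` has `i + c` equal to the corank of `F`.
  have hsingle : ∀ (F : P) (c : ℕ), ∑ i ∈ Finset.range k,
      (if intervalRank F ⊤ = i + c then (f F).coeff i else 0) =
      if c ≤ intervalRank F ⊤ ∧ intervalRank F ⊤ < k + c then
        (f F).coeff (intervalRank F ⊤ - c) else 0 := by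
    intro F c
    split_ifs with h
    · rw [Finset.sum_eq_single (intervalRank F ⊤ - c)]
      · rw [if_pos (by omega)]
      · intro i _ hi
        rw [if_neg (by omega)]
      · intro h'
        rw [Finset.mem_range] at h'
        omega
    · refine Finset.sum_eq_zero fun i hi => ?_
      rw [Finset.mem_range] at hi
      rw [if_neg (by omega)]
  have hup : (zPoly f a).coeff k =
      ∑ i ∈ Finset.range k, levelSum (i + k) (fun F => (f F).coeff i) a := by
    rw [h1, sum_levelSum (Finset.range k) (· + k)]
    refine Finset.sum_congr rfl fun F _ => ?_
    rw [hsingle]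
    split_ifs with h2 h3 h3
    · rfl
    -- Here the corank of `F` is at least `2 * k`, so the degree bound kills the coefficient.
    · have := hf.degree_lt F (by omega)
      exact coeff_eq_zero_of_natDegree_lt (by omega)
    · omega
    · rfl
  have hlow : (zPoly f a).coeff k = (f a).coeff k +
      ∑ i ∈ Finset.range k, levelSum (i + D) (fun F => (f F).coeff i) a := by
    rw [coeff_zPoly, sum_levelSum (Finset.range k) (· + D),
      ← Finset.Ioc_insert_left (le_top : a ≤ ⊤), Finset.sum_insert (by simp),
      Finset.sum_insert (by simp)]
    have h0 : intervalRank a a = 0 := by simp [intervalRank]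
    -- The term `F = a` would need `i = k`, which is outside the range: it is the coefficient being
    -- solved for.
    have h1' : ¬ (D ≤ intervalRank a ⊤ ∧ intervalRank a ⊤ < k + D) := by omega
    rw [hsingle a D, if_neg h1', zero_add, h0, if_pos (Nat.zero_le _), Nat.sub_zero]
    congr 1
    refine Finset.sum_congr rfl fun F hF => ?_
    rw [Finset.mem_Ioc] at hF
    have h2 := intervalRank_add hF.1.le hF.2
    have h3 := intervalRank_pos hF.1
    rw [hsingle]
    have h4 : intervalRank F ⊤ - D = k - intervalRank a F ∨ ¬ intervalRank a F ≤ k := by omega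
    rcases h4 with h4 | h4
    · rw [h4]
      exact if_congr (by omega) rfl rfl
    · rw [if_neg h4, if_neg (by omega)]
  rw [Finset.sum_sub_distrib, ← hup, hlow]
  ring

/-- The number of multichains above `a` with prescribed coranks. -/
def chainCount : List ℕ → P → ℤ
  | [] => fun _ => 1
  | n :: l => levelSum n (chainCount l)

end Recursion

/-! ### Words recording the branches of the recursion -/

theorem getLast_le_of_pairwise {l : List ℕ} (hl : l.Pairwise (· > ·)) (hne : l ≠ []) {n : ℕ}
    (hn : n ∈ l) : l.getLast hne ≤ n := by
  rw [← List.dropLast_append_getLast hne] at hn hl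
  rcases List.mem_append.1 hn with hn | hn
  · exact ((List.pairwise_append.1 hl).2.2 n hn _ (List.mem_singleton_self _)).le
  · rw [List.mem_singleton.1 hn]

/-- Words encoding the elements of `indexS k` for an interval of rank `k + D`: one descends from
corank `k + D` either by a step to corank `j + D`, or by a jump to corank `i + k`, and stops by
a step to corank `D`. -/
inductive KLPath : ℕ → ℕ → Type
  | halt {k D : ℕ} (hk : 0 < k) : KLPath k D
  | step {k D j : ℕ} (h0 : 0 < j) (hj : j < k) (p : KLPath j D) : KLPath k D
  | jump {k D i : ℕ} (h0 : 0 < i) (hi : i < k) (p : KLPath i k) : KLPath k D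

namespace KLPath

/-- The coranks visited before the first jump, including the final one if there is no jump. -/
def head : {k D : ℕ} → KLPath k D → List ℕ
  | _, D, halt _ => [D]
  | _, D, step (j := j) _ _ p => (j + D) :: p.head
  | _, _, jump _ _ _ => []

/-- The coranks visited from the first jump on. -/
def tail : {k D : ℕ} → KLPath k D → List ℕ
  | _, _, halt _ => []
  | _, _, step _ _ p => p.tail
  | k, _, jump (i := i) _ _ p => (i + k) :: (p.head ++ p.tail)

/-- All the coranks visited. -/
def coranks {k D : ℕ} (p : KLPath k D) : List ℕ := p.head ++ p.tail

/-- The coranks visited, except for the last one. -/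
def init : {k D : ℕ} → KLPath k D → List ℕ
  | _, _, halt _ => []
  | _, D, step (j := j) _ _ p => (j + D) :: p.init
  | k, _, jump (i := i) _ _ p => (i + k) :: p.init

/-- The last corank visited. -/
def last : {k D : ℕ} → KLPath k D → ℕ
  | _, D, halt _ => D
  | _, _, step _ _ p => p.last
  | _, _, jump _ _ p => p.last

/-- The length of the final step. -/
def drop : {k D : ℕ} → KLPath k D → ℕ
  | k, _, halt _ => k
  | _, _, step _ _ p => p.drop
  | _, _, jump _ _ p => p.drop

/-- The number of steps, except for the final one. -/
def signLength : {k D : ℕ} → KLPath k D → ℕ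
  | _, _, halt _ => 0
  | _, _, step _ _ p => p.signLength + 1
  | _, _, jump _ _ p => p.signLength

theorem pos {k D : ℕ} (p : KLPath k D) : 0 < k := by
  cases p <;> omega

theorem coranks_halt {k D : ℕ} (hk : 0 < k) : (halt (D := D) hk).coranks = [D] := rfl

theorem coranks_step {k D j : ℕ} (h0 : 0 < j) (hj : j < k) (p : KLPath j D) :
    (step h0 hj p).coranks = (j + D) :: p.coranks := rfl

theorem coranks_jump {k D i : ℕ} (h0 : 0 < i) (hi : i < k) (p : KLPath i k) :
    (jump (D := D) h0 hi p).coranks = (i + k) :: p.coranks := rfl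

theorem coranks_ne_nil {k D : ℕ} (p : KLPath k D) : p.coranks ≠ [] := by
  cases p <;> simp [coranks_halt, coranks_step, coranks_jump]

theorem coranks_eq {k D : ℕ} (p : KLPath k D) : p.coranks = p.init ++ [p.last] := by
  induction p with
  | halt _ => rfl
  | step _ _ p ih => rw [coranks_step, ih]; rfl
  | jump _ _ p ih => rw [coranks_jump, ih]; rfl

theorem lt_of_mem_coranks {k D n : ℕ} (p : KLPath k D) (hD : k < D) (hn : n ∈ p.coranks) :
    n < k + D := by
  induction p with
  | halt h => rw [coranks_halt, List.mem_singleton] at hn; omega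
  | step _ _ p ih =>
    rw [coranks_step, List.mem_cons] at hn
    rcases hn with rfl | hn
    · omega
    · have := ih (by omega) hn
      omega
  | jump _ _ p ih =>
    rw [coranks_jump, List.mem_cons] at hn
    rcases hn with rfl | hn
    · omega
    · have := ih (by omega) hn
      omega

theorem pairwise_coranks {k D : ℕ} (p : KLPath k D) (hD : k < D) : p.coranks.Pairwise (· > ·) := by
  induction p with
  | halt h => simp [coranks_halt]
  | step _ _ p ih =>
    rw [coranks_step, List.pairwise_cons]
    exact ⟨fun n hn => p.lt_of_mem_coranks (by omega) hn, ih (by omega)⟩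
  | jump _ _ p ih =>
    rw [coranks_jump, List.pairwise_cons]
    exact ⟨fun n hn => p.lt_of_mem_coranks (by omega) hn, ih (by omega)⟩

/-- The final step goes from the penultimate corank (the start `k + D` if there is none) to the last
one. This later identifies `drop` with the shift `d(I)`. -/
theorem getLast_init {k D : ℕ} (p : KLPath k D) :
    ((k + D) :: p.init).getLast (List.cons_ne_nil _ _) = p.drop + p.last := by
  induction p with
  | halt _ => rfl
  | step _ _ p ih => simpa [init, drop, last] using ih
  | jump _ _ p ih => simpa [init, drop, last] using ih

/-- The penultimate corank is `drop + last` and `last` is positive, so replacing `last` by `drop`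
keeps the list decreasing. -/
theorem pairwise_init_drop {k D : ℕ} (p : KLPath k D) (hD : k < D) :
    (p.init ++ [p.drop]).Pairwise (· > ·) := by
  have h0 : 0 < p.last := by
    induction p with
    | halt _ => simp only [last]; omega
    | step _ _ p ih => exact ih (by omega)
    | jump _ _ p ih => exact ih (by omega)
  have h1 := p.pairwise_coranks hD
  have h2 := p.getLast_init
  rw [coranks_eq, List.pairwise_append] at h1
  rw [List.pairwise_append]
  refine ⟨h1.1, List.pairwise_singleton _ _, fun n hn m hm => ?_⟩
  rw [List.mem_singleton] at hm
  subst hm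
  have hne : p.init ≠ [] := List.ne_nil_of_mem hn
  rw [List.getLast_cons hne] at h2
  have h3 := getLast_le_of_pairwise h1.1 hne hn
  omega

theorem drop_lt {k D : ℕ} (p : KLPath k D) (hD : k < D) : p.drop < k + D := by
  induction p with
  | halt _ => simp only [drop]; omega
  | step _ _ p ih => have := ih (by omega); simp only [drop]; omega
  | jump _ _ p ih => have := ih (by omega); simp only [drop]; omega

/-- A word is determined by its coranks. -/
theorem heq_of_coranks_eq {k D : ℕ} (p : KLPath k D) : ∀ {k' D' : ℕ} (q : KLPath k' D'),
    k + D = k' + D' → k < D → k' < D' → p.coranks = q.coranks → k = k' ∧ D = D' ∧ p ≍ q := by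
  -- The parameters of `q` stay free, with only the sums equal: after one letter nothing more is
  -- known about the remaining words.
  induction p with
  | @halt k D hk =>
    intro k' D' q hs hD hD' h
    cases q with
    | halt hk' =>
      simp only [coranks_halt, List.cons.injEq, and_true] at h
      obtain rfl : k = k' := by omega
      subst h
      exact ⟨rfl, rfl, HEq.rfl⟩
    | step _ _ q =>
      rw [coranks_halt, coranks_step, List.cons.injEq] at h
      exact absurd h.2.symm q.coranks_ne_nil
    | jump _ _ q =>
      rw [coranks_halt, coranks_jump, List.cons.injEq] at h
      exact absurd h.2.symm q.coranks_ne_nil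
  | @step k D j h0 hj p ih =>
    intro k' D' q hs hD hD' h
    cases q with
    | halt hk' =>
      rw [coranks_halt, coranks_step, List.cons.injEq] at h
      exact absurd h.2 p.coranks_ne_nil
    | step _ _ q =>
      rw [coranks_step, coranks_step, List.cons.injEq] at h
      obtain ⟨rfl, rfl, h3⟩ := ih q h.1 (by omega) (by omega) h.2
      obtain rfl : k = k' := by omega
      rw [eq_of_heq h3]
      exact ⟨rfl, rfl, HEq.rfl⟩
    | jump _ _ q =>
      rw [coranks_step, coranks_jump, List.cons.injEq] at h
      -- A step against a jump forces `k' = D` and hence `D' = k`, contradicting `k < D` and `k' <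
      -- D'`.
      obtain ⟨rfl, rfl, h3⟩ := ih q h.1 (by omega) (by omega) h.2
      omega
  | @jump k D i h0 hi p ih =>
    intro k' D' q hs hD hD' h
    cases q with
    | halt hk' =>
      rw [coranks_halt, coranks_jump, List.cons.injEq] at h
      exact absurd h.2 p.coranks_ne_nil
    | step _ _ q =>
      rw [coranks_step, coranks_jump, List.cons.injEq] at h
      obtain ⟨rfl, rfl, h3⟩ := ih q h.1 (by omega) (by omega) h.2
      omega
    | jump _ _ q =>
      rw [coranks_jump, coranks_jump, List.cons.injEq] at h
      obtain ⟨rfl, rfl, h3⟩ := ih q h.1 (by omega) (by omega) h.2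
      obtain rfl : D = D' := by omega
      rw [eq_of_heq h3]
      exact ⟨rfl, rfl, HEq.rfl⟩

theorem coranks_injective {k D : ℕ} (hD : k < D) :
    Function.Injective (coranks : KLPath k D → List ℕ) :=
  fun p q h => eq_of_heq (p.heq_of_coranks_eq q rfl hD hD h).2.2

/-- A word ends at once, or starts with a step, or starts with a jump. -/
def equivSum {k D : ℕ} (hk : 0 < k) : KLPath k D ≃
    Unit ⊕ ((j : {j : Fin k // 0 < (j : ℕ)}) × (KLPath j D ⊕ KLPath j k)) where
  toFun
    | halt _ => .inl ()
    | step h0 hj p => .inr ⟨⟨⟨_, hj⟩, h0⟩, .inl p⟩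
    | jump h0 hi p => .inr ⟨⟨⟨_, hi⟩, h0⟩, .inr p⟩
  invFun
    | .inl () => halt hk
    | .inr ⟨j, .inl p⟩ => step j.2 j.1.2 p
    | .inr ⟨j, .inr p⟩ => jump j.2 j.1.2 p
  left_inv p := by cases p <;> rfl
  right_inv x := by
    rcases x with _ | ⟨_, _ | _⟩ <;> rfl

instance instFinite (k D : ℕ) : Finite (KLPath k D) := by
  induction k using Nat.strong_induction_on generalizing D with
  | _ k ih =>
  rcases Nat.eq_zero_or_pos k with rfl | hk
  · exact @Finite.of_subsingleton _ ⟨fun p => absurd p.pos (lt_irrefl 0)⟩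
  · have (j : {j : Fin k // 0 < (j : ℕ)}) : Finite (KLPath j D ⊕ KLPath j k) :=
      have := ih j j.1.2 D
      have := ih j j.1.2 k
      inferInstance
    exact Finite.of_equiv _ (equivSum hk).symm

noncomputable instance (k D : ℕ) : Fintype (KLPath k D) := Fintype.ofFinite _

theorem sum_eq {k D : ℕ} (hk : 0 < k) (g : KLPath k D → ℤ) : ∑ p, g p = g (halt hk) +
    ∑ j : {j : Fin k // 0 < (j : ℕ)},
      (∑ p : KLPath j D, g (step j.2 j.1.2 p) + ∑ p : KLPath j k, g (jump j.2 j.1.2 p)) := by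
  rw [← (equivSum hk).symm.sum_comp, Fintype.sum_sum_type, Fintype.sum_sigma]
  simp only [Fintype.sum_sum_type]
  simp [equivSum]

end KLPath

/-! ### Unrolling the coefficient recursion over words -/

theorem sum_range_eq_add_sum_pos {k : ℕ} (hk : 0 < k) (g : ℕ → ℤ) :
    ∑ i ∈ Finset.range k, g i = g 0 + ∑ j : {j : Fin k // 0 < (j : ℕ)}, g j := by
  obtain ⟨k, rfl⟩ := Nat.exists_eq_add_one.2 hk
  have h : ∑ j : {j : Fin (k + 1) // 0 < (j : ℕ)}, g (j.1 : ℕ) =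
      ∑ j ∈ (Finset.univ : Finset (Fin (k + 1))).filter (fun j : Fin (k + 1) => 0 < (j : ℕ)),
        g (j : ℕ) :=
    (Finset.sum_subtype _ (fun x => by simp) (fun j : Fin (k + 1) => g j)).symm
  rw [h, ← Fin.sum_univ_eq_sum_range, Finset.sum_filter, Fin.sum_univ_succ, Fin.sum_univ_succ]
  simp

section Recursion

set_option linter.unusedSectionVars false

variable {P : Type*} [PartialOrder P] [BoundedOrder P] [LocallyFiniteOrder P] [DecidableEq P]
  [GradeMinOrder ℕ P]

theorem levelSum_congr {n : ℕ} {g h : P → ℤ} {a : P}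
    (H : ∀ F, intervalRank F ⊤ = n → g F = h F) : levelSum n g a = levelSum n h a :=
  Finset.sum_congr rfl fun F hF => H F (Finset.mem_filter.1 hF).2

theorem levelSum_sum {ι : Type*} (s : Finset ι) (n : ℕ) (g : ι → P → ℤ) (a : P) :
    levelSum n (fun F => ∑ i ∈ s, g i F) a = ∑ i ∈ s, levelSum n (g i) a :=
  Finset.sum_comm

theorem levelSum_mul_sub (n : ℕ) (c : ℤ) (g h : P → ℤ) (a : P) :
    levelSum n (fun F => c * (g F - h F)) a = c * (levelSum n g a - levelSum n h a) := by
  simp only [levelSum, ← Finset.mul_sum, Finset.sum_sub_distrib]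

/-- The term `i = 0` of the recursion is the word that halts. For `j > 0`, corank `j + k` is a jump
and corank `j + D` a step, which costs a sign; the inequalities `j < k` and `j < D` let the
induction continue. -/
theorem IsKLFamily.coeff_eq_sum_paths {f : P → ℤ[X]} (hf : IsKLFamily f) {k D : ℕ} (hk : 0 < k)
    (hD : k < D) (a : P) (ha : intervalRank a ⊤ = k + D) :
    (f a).coeff k = ∑ p : KLPath k D, (-1) ^ p.signLength *
      (chainCount (p.init ++ [p.drop]) a - chainCount p.coranks a) := by
  induction k using Nat.strong_induction_on generalizing D a with
  | _ k ih =>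
  rw [hf.coeff_recursion hk hD a ha, sum_range_eq_add_sum_pos hk
    (fun i => levelSum (i + k) (fun F => (f F).coeff i) a -
      levelSum (i + D) (fun F => (f F).coeff i) a), KLPath.sum_eq hk]
  congr 1
  · simp [hf.coeff_zero, KLPath.signLength, KLPath.coranks_halt, KLPath.init, KLPath.drop,
      chainCount]
  · refine Finset.sum_congr rfl fun j _ => ?_
    rw [levelSum_congr (n := j + k) fun F hF => ih j j.1.2 j.2 j.1.2 F hF,
      levelSum_congr (n := j + D) fun F hF => ih j j.1.2 j.2 (j.1.2.trans hD) F hF,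
      levelSum_sum, levelSum_sum, sub_eq_neg_add, ← Finset.sum_neg_distrib]
    congr 1 <;> refine Finset.sum_congr rfl fun p _ => ?_
    · rw [levelSum_mul_sub]
      simp only [KLPath.signLength, KLPath.coranks_step, KLPath.init, KLPath.drop, chainCount,
        List.cons_append, pow_succ]
      ring
    · rw [levelSum_mul_sub]
      rfl

end Recursion

/-! ### Translating coranks into constants and polynomials `r - n` -/

/-- The constants `R - n`, for `n` in `l`. -/
noncomputable def constPart (R : ℕ) (l : List ℕ) : Finset ℤ[X] :=
  l.toFinset.image fun n : ℕ => C ((R : ℤ) - n)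

/-- The polynomials `r - n`, for `n` in `l`. -/
noncomputable def varPart (l : List ℕ) : Finset ℤ[X] :=
  l.toFinset.image fun n : ℕ => X - C (n : ℤ)

theorem mem_constPart {R : ℕ} {l : List ℕ} {f : ℤ[X]} :
    f ∈ constPart R l ↔ ∃ n ∈ l, C ((R : ℤ) - n) = f := by
  simp [constPart]

theorem mem_varPart {l : List ℕ} {f : ℤ[X]} :
    f ∈ varPart l ↔ ∃ n ∈ l, X - C (n : ℤ) = f := by
  simp [varPart]

theorem X_sub_C_ne_C (m n : ℤ) : (X - C m : ℤ[X]) ≠ C n := by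
  intro h
  have := congrArg natDegree h
  rw [natDegree_X_sub_C, natDegree_C] at this
  exact one_ne_zero this

theorem X_sub_C_inj {m n : ℤ} : (X - C m : ℤ[X]) = X - C n ↔ m = n := by
  simp

theorem X_sub_C_mem_constPart_union {R : ℕ} {l l' : List ℕ} {m : ℤ} :
    X - C m ∈ constPart R l ∪ varPart l' ↔ ∃ n ∈ l', m = n := by
  rw [Finset.mem_union, mem_constPart, mem_varPart]
  constructor
  · rintro (⟨n, hn, h⟩ | ⟨n, hn, h⟩)
    · exact absurd h.symm (X_sub_C_ne_C _ _)
    · exact ⟨n, hn, (X_sub_C_inj.1 h).symm⟩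
  · rintro ⟨n, hn, rfl⟩
    exact .inr ⟨n, hn, rfl⟩

theorem varPart_append (l l' : List ℕ) : varPart (l ++ l') = varPart l ∪ varPart l' := by
  simp [varPart, Finset.image_union]

theorem image_eval_constPart (R : ℕ) (l : List ℕ) :
    (constPart R l).image (eval (R : ℤ)) = l.toFinset.image fun n : ℕ => (R : ℤ) - n := by
  simp [constPart, Finset.image_image, Function.comp_def]

theorem image_eval_varPart (R : ℕ) (l : List ℕ) :
    (varPart l).image (eval (R : ℤ)) = l.toFinset.image fun n : ℕ => (R : ℤ) - n := by
  simp [varPart, Finset.image_image, Function.comp_def]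

theorem image_eval_constPart_union (R : ℕ) (l l' : List ℕ) :
    (constPart R l ∪ varPart l').image (eval (R : ℤ)) =
      (l ++ l').toFinset.image fun n : ℕ => (R : ℤ) - n := by
  rw [Finset.image_union, image_eval_constPart, image_eval_varPart, List.toFinset_append,
    Finset.image_union]

/-- At `r = s` both the constant `s - n` and the polynomial `r - n` take the value `s - n`, which
`F_s` turns into `r - n`. So `F_s` keeps coranks and forgets which of them were constant. -/
theorem shiftF_constPart_union (s : ℕ) (l l' : List ℕ) :
    shiftF s (constPart s l ∪ varPart l') = varPart (l ++ l') := by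
  have h (n : ℤ) : C ((s : ℤ) - n) + X - C (s : ℤ) = X - C n := by
    rw [C_sub]; ring
  rw [shiftF, Finset.image_union, varPart_append]
  simp only [constPart, varPart, Finset.image_image, Function.comp_def, eval_C, eval_sub, eval_X, h]

theorem glue_constPart_union (s R : ℕ) (l l₁ l₂ : List ℕ) :
    glue s (constPart R l) (constPart s l₁ ∪ varPart l₂) =
      constPart R l ∪ varPart (s :: (l₁ ++ l₂)) := by
  rw [glue, shiftF_constPart_union, Finset.union_assoc]
  congr 1
  ext f
  simp [varPart]

theorem mem_indexA {t : ℕ} {I : Finset ℤ[X]} : I ∈ indexA t ↔ t = 0 ∧ I = ∅ ∨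
    0 < t ∧ ∃ J ⊆ Finset.Icc 1 t, t ∈ J ∧ J.image (fun n : ℕ => C (n : ℤ)) = I := by
  unfold indexA
  split_ifs with h
  · simp [h]
  · simp [h, Nat.pos_of_ne_zero h, and_assoc]

theorem mem_indexS {k : ℕ} {I : Finset ℤ[X]} : I ∈ indexS k ↔ I ∈ indexA k ∨
    ∃ (s : ℕ) (i : Fin k) (α β : Finset ℤ[X]), Admissible k s i ∧ α ∈ indexA (k + i - s) ∧
      β ∈ indexS i ∧ I = glue s α β := by
  rw [indexS, Finset.mem_union, Finset.mem_biUnion]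
  refine or_congr Iff.rfl ?_
  constructor
  · rintro ⟨s, _, hI⟩
    obtain ⟨i, hi, hI⟩ := Finset.mem_biUnion.1 hI
    obtain ⟨α, hα, β, hβ, rfl⟩ := Finset.mem_image₂.1 hI
    exact ⟨s, i, α, β, (Finset.mem_filter.1 hi).2, hα, hβ, rfl⟩
  · rintro ⟨s, i, α, β, h, hα, hβ, rfl⟩
    exact ⟨s, Finset.mem_Icc.2 ⟨h.1, h.2.1⟩, Finset.mem_biUnion.2
      ⟨i, Finset.mem_filter.2 ⟨Finset.mem_univ _, h⟩, Finset.mem_image₂.2 ⟨α, hα, β, hβ, rfl⟩⟩⟩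

theorem X_sub_C_notMem_indexA {t : ℕ} {I : Finset ℤ[X]} (hI : I ∈ indexA t) (n : ℤ) :
    X - C n ∉ I := by
  rcases mem_indexA.1 hI with ⟨_, rfl⟩ | ⟨_, J, _, _, rfl⟩
  · simp
  · intro h
    obtain ⟨m, _, h⟩ := Finset.mem_image.1 h
    exact X_sub_C_ne_C _ _ h.symm

/-- The map `n ↦ R - n` carries the coranks in `[c, R)` to `{1, …, t}`, and the least corank `c` to
the compulsory element `t`. -/
theorem constPart_mem_indexA {R c t : ℕ} {l : List ℕ} (hR : c + t = R) (ht : 0 < t)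
    (hc : c ∈ l) (hl : ∀ n ∈ l, c ≤ n ∧ n < R) : constPart R l ∈ indexA t := by
  refine mem_indexA.2 (.inr ⟨ht, l.toFinset.image (fun n => R - n), ?_, ?_, ?_⟩)
  · intro x hx
    obtain ⟨n, hn, rfl⟩ := Finset.mem_image.1 hx
    have := hl n (List.mem_toFinset.1 hn)
    rw [Finset.mem_Icc]
    omega
  · exact Finset.mem_image.2 ⟨c, List.mem_toFinset.2 hc, by omega⟩
  · rw [Finset.image_image]
    refine Finset.image_congr fun n hn => ?_
    have := hl n (List.mem_toFinset.1 hn)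
    simp [Nat.cast_sub this.2.le]

theorem exists_of_mem_indexA {R c t : ℕ} {I : Finset ℤ[X]} (hR : c + t = R) (ht : 0 < t)
    (hI : I ∈ indexA t) : ∃ N : Finset ℕ, c ∈ N ∧ (∀ n ∈ N, c ≤ n ∧ n < R) ∧
      N.image (fun n : ℕ => C ((R : ℤ) - n)) = I := by
  rcases mem_indexA.1 hI with ⟨h, _⟩ | ⟨_, J, hJ, htJ, rfl⟩
  · omega
  refine ⟨J.image fun m => R - m, Finset.mem_image.2 ⟨t, htJ, by omega⟩, ?_, ?_⟩
  · intro n hn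
    obtain ⟨m, hm, rfl⟩ := Finset.mem_image.1 hn
    have := Finset.mem_Icc.1 (hJ hm)
    omega
  · rw [Finset.image_image]
    refine Finset.image_congr fun m hm => ?_
    have := Finset.mem_Icc.1 (hJ hm)
    simp [Nat.cast_sub (show m ≤ R by omega)]

theorem card_image_C_sub (R : ℕ) (N : Finset ℕ) :
    (N.image (fun n : ℕ => (C ((R : ℤ) - n) : ℤ[X]))).card = N.card :=
  Finset.card_image_of_injective _ fun m n h => by
    have := C_inj.1 h
    omega

/-! ### The bijection between words and index sets, and the signs -/

namespace KLPath

/-- The element of `indexS k` encoded by a word. -/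
noncomputable def toFinset {k D : ℕ} (p : KLPath k D) : Finset ℤ[X] :=
  constPart (k + D) p.head ∪ varPart p.tail

theorem image_eval_toFinset {k D : ℕ} (p : KLPath k D) :
    p.toFinset.image (eval ((k + D : ℕ) : ℤ)) =
      p.coranks.toFinset.image fun n : ℕ => ((k + D : ℕ) : ℤ) - n :=
  image_eval_constPart_union _ _ _

/-- Evaluation at `r = k + D` recovers the set of coranks, hence the decreasing list, hence the
word. -/
theorem toFinset_injective {k D : ℕ} (hD : k < D) :
    Function.Injective (toFinset : KLPath k D → Finset ℤ[X]) := by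
  intro p q h
  have h1 := congrArg (Finset.image (eval ((k + D : ℕ) : ℤ))) h
  rw [image_eval_toFinset, image_eval_toFinset] at h1
  have h2 := Finset.image_injective (fun m n h => by simpa using h) h1
  have hp := p.pairwise_coranks hD
  have hq := q.pairwise_coranks hD
  have h3 := List.perm_of_nodup_nodup_toFinset_eq hp.nodup hq.nodup h2
  exact coranks_injective hD
    (h3.eq_of_pairwise (fun _ _ _ _ h1 h2 => absurd h1 (lt_asymm h2)) hp hq)

/-- The elements of `N` become the targets of steps, taken in decreasing order; the least one, `j +
D`, is where `p` starts. Adding the maximum last in the induction makes it the first step. -/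
theorem exists_prepend_finset {j D : ℕ} (p : KLPath j D) (N : Finset ℕ) (hN : ∀ n ∈ N, j + D ≤ n)
    (hj : j + D ∈ N) : ∀ k, (∀ n ∈ N, n < k + D) → ∃ q : KLPath k D,
      q.head.toFinset = N ∪ p.head.toFinset ∧ q.tail = p.tail ∧
      q.signLength = N.card + p.signLength := by
  induction N using Finset.induction_on_max with
  | empty => simp at hj
  | insert x N hx ih =>
    intro k hk
    have hxk := hk x (Finset.mem_insert_self _ _)
    have hxj := hN x (Finset.mem_insert_self _ _)
    have hp := p.pos
    rcases eq_or_ne x (j + D) with rfl | hne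
    · obtain rfl : N = ∅ := Finset.eq_empty_of_forall_notMem fun n hn => by
        have h1 := hx n hn
        have h2 := hN n (Finset.mem_insert_of_mem hn)
        omega
      exact ⟨step hp (by omega) p, by simp [head], rfl, by simp [signLength, add_comm]⟩
    · have hjN : j + D ∈ N := (Finset.mem_insert.1 hj).resolve_left hne.symm
      obtain ⟨m, rfl⟩ := Nat.exists_eq_add_of_le' (show D ≤ x by omega)
      obtain ⟨q, h1, h2, h3⟩ := ih (fun n hn => hN n (Finset.mem_insert_of_mem hn)) hjN m hx
      refine ⟨step (j := m) q.pos (by omega) q, ?_, by simpa only [tail] using h2, ?_⟩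
      · simp [head, h1]
      · rw [Finset.card_insert_of_notMem fun h => lt_irrefl _ (hx _ h)]
        simp only [signLength, h3]
        omega

theorem exists_prepend {j k D : ℕ} (hjk : j ≤ k) (p : KLPath j D) {α : Finset ℤ[X]}
    (hα : α ∈ indexA (k - j)) : ∃ q : KLPath k D,
      constPart (k + D) q.head = α ∪ constPart (k + D) p.head ∧ q.tail = p.tail ∧
      q.signLength = α.card + p.signLength := by
  rcases hjk.eq_or_lt with rfl | hjk
  · obtain rfl : α = ∅ := by
      rcases mem_indexA.1 hα with ⟨_, h⟩ | ⟨h, _⟩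
      · exact h
      · omega
    exact ⟨p, by simp, rfl, by simp⟩
  · obtain ⟨N, h1, h2, rfl⟩ := exists_of_mem_indexA (R := k + D) (c := j + D) (by omega)
      (by omega) hα
    obtain ⟨q, h3, h4, h5⟩ := p.exists_prepend_finset N (fun n hn => (h2 n hn).1) h1 k
      fun n hn => (h2 n hn).2
    refine ⟨q, ?_, h4, ?_⟩
    · rw [constPart, h3, Finset.image_union]
      rfl
    · rw [h5, card_image_C_sub]

theorem exists_toFinset_eq_of_mem_indexA {k : ℕ} (hk : 0 < k) (D : ℕ) {I : Finset ℤ[X]}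
    (hI : I ∈ indexA k) : ∃ q : KLPath k D, q.toFinset = I ∧ q.signLength = I.card - 1 := by
  obtain ⟨N, h1, h2, rfl⟩ := exists_of_mem_indexA (R := k + D) (c := D) (by omega) hk hI
  rw [card_image_C_sub]
  have hcard : (N.erase D).card = N.card - 1 := Finset.card_erase_of_mem h1
  rcases (N.erase D).eq_empty_or_nonempty with h | h
  · refine ⟨halt hk, ?_, ?_⟩
    · rw [← Finset.insert_erase h1, h]
      simp [toFinset, constPart, varPart, head, tail]
    · rw [← hcard, h]
      rfl
  -- The least corank above `D` is where the final halt starts. The halt accounts for `D` itself and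
  -- is not counted in the sign, whence `|I| - 1`.
  · have hm := (N.erase D).min'_mem h
    obtain ⟨hm1, hm2⟩ := Finset.mem_erase.1 hm
    have hm3 := h2 _ hm2
    obtain ⟨j, hj⟩ := Nat.exists_eq_add_of_le' hm3.1
    obtain ⟨q, h3, h4, h5⟩ := (halt (k := j) (D := D) (by omega)).exists_prepend_finset (N.erase D)
      (fun n hn => hj ▸ Finset.min'_le _ n hn) (hj ▸ hm) k
      fun n hn => (h2 n (Finset.mem_of_mem_erase hn)).2
    refine ⟨q, ?_, ?_⟩
    · rw [toFinset, h4, constPart, h3]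
      have : N.erase D ∪ {D} = N := by
        rw [Finset.union_comm, ← Finset.insert_eq, Finset.insert_erase h1]
      simp [head, tail, varPart, this]
    · rw [h5, hcard]
      rfl

/-- The set `α` lists the steps from `k` down to `j`; the jump from `(j, D)` to `(i, j)` then lands
at corank `s = i + j`. -/
theorem exists_toFinset_eq_glue {k i j : ℕ} (D : ℕ) (hij : i < j) (hjk : j ≤ k) {α : Finset ℤ[X]}
    (hα : α ∈ indexA (k - j)) (p : KLPath i j) : ∃ q : KLPath k D,
      q.toFinset = glue (i + j) α p.toFinset ∧ q.signLength = α.card + p.signLength := by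
  obtain ⟨q, h1, h2, h3⟩ := (jump (D := D) p.pos hij p).exists_prepend hjk hα
  refine ⟨q, ?_, h3⟩
  rw [toFinset, h1, h2, toFinset, glue, shiftF_constPart_union, Finset.union_assoc]
  ext f
  simp [head, tail, constPart, varPart]

/-- Splitting at the first jump mirrors the definition of `indexS`: no jump gives `A_k`, a first
jump from `(j, D)` to `(i, j)` gives `T_k^s(i)` with `s = i + j`. -/
theorem tail_cases {k D : ℕ} (p : KLPath k D) :
    (p.tail = [] ∧ D ∈ p.head ∧ ∀ n ∈ p.head, D ≤ n ∧ n < k + D) ∨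
    ∃ (i j : ℕ) (p' : KLPath i j), i < j ∧ j ≤ k ∧ p.tail = (i + j) :: p'.coranks ∧
      (j < k → j + D ∈ p.head) ∧ (j = k → p.head = []) ∧ ∀ n ∈ p.head, j + D ≤ n ∧ n < k + D := by
  induction p with
  | halt hk => exact .inl (by simp [head, tail, hk])
  | jump _ hi p => exact .inr ⟨_, _, p, hi, le_rfl, by simp [head, tail, coranks]⟩
  | @step k D m h0 hm p ih =>
    rcases ih with ⟨h1, h2, h3⟩ | ⟨i, j, p', h1, h2, h3, h4, h5, h6⟩
    · refine .inl ⟨h1, List.mem_cons_of_mem _ h2, fun n hn => ?_⟩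
      rcases List.mem_cons.1 hn with rfl | hn
      · omega
      · have := h3 n hn
        omega
    · refine .inr ⟨i, j, p', h1, by omega, h3, fun _ => ?_, by omega, fun n hn => ?_⟩
      · rcases h2.eq_or_lt with rfl | h
        · exact List.mem_cons_self
        · exact List.mem_cons_of_mem _ (h4 h)
      · rcases List.mem_cons.1 hn with rfl | hn
        · omega
        · have := h6 n hn
          omega

theorem toFinset_mem_indexA {k D : ℕ} (p : KLPath k D) (h : p.tail = []) :
    p.toFinset ∈ indexA k := by
  rcases p.tail_cases with ⟨_, h2, h3⟩ | ⟨i, j, p', _, _, h3, _⟩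
  · have : p.toFinset = constPart (k + D) p.head := by simp [toFinset, h, varPart]
    rw [this]
    exact constPart_mem_indexA (add_comm _ _) p.pos h2 h3
  · simp [h] at h3

theorem toFinset_notMem_indexA {k D : ℕ} (p : KLPath k D) (h : p.tail ≠ []) :
    p.toFinset ∉ indexA k := fun hA =>
  X_sub_C_notMem_indexA hA _
    (X_sub_C_mem_constPart_union.2 ⟨_, List.head_mem h, rfl⟩)

theorem toFinset_mem_indexS {k D : ℕ} (p : KLPath k D) : p.toFinset ∈ indexS k := by
  induction k using Nat.strong_induction_on generalizing D with
  | _ k ih =>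
  by_cases hA : p.tail = []
  · exact mem_indexS.2 (.inl (p.toFinset_mem_indexA hA))
  rcases p.tail_cases with h | ⟨i, j, p', hij, hjk, h3, h4, h5, h6⟩
  · exact absurd h.1 hA
  have hi := p'.pos
  refine mem_indexS.2 (.inr ⟨i + j, ⟨i, by omega⟩, constPart (k + D) p.head, p'.toFinset, ?_, ?_,
    ih i (by omega) p', ?_⟩)
  -- With `s = i + j`, admissibility amounts to `1 ≤ i < j ≤ k`.
  · simp only [Admissible]
    omega
  · have : k + i - (i + j) = k - j := by omega
    rw [this]
    rcases hjk.eq_or_lt with rfl | h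
    · simp [h5 rfl, constPart, indexA]
    · exact constPart_mem_indexA (c := j + D) (by omega) (by omega) (h4 h) h6
  · rw [toFinset, toFinset, glue_constPart_union, h3]
    rfl

theorem exists_toFinset_eq {k : ℕ} (hk : 0 < k) (D : ℕ) {I : Finset ℤ[X]} (hI : I ∈ indexS k) :
    ∃ p : KLPath k D, p.toFinset = I := by
  induction k using Nat.strong_induction_on generalizing D I with
  | _ k ih =>
  rcases mem_indexS.1 hI with hA | ⟨s, i, α, β, ⟨h1, h2, h3, h4⟩, hα, hβ, rfl⟩
  · obtain ⟨q, hq, _⟩ := exists_toFinset_eq_of_mem_indexA hk D hA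
    exact ⟨q, hq⟩
  · obtain ⟨j, rfl⟩ := Nat.exists_eq_add_of_le (show (i : ℕ) ≤ s by omega)
    obtain ⟨p, rfl⟩ := ih i i.2 (by omega) j hβ
    have : k + i - (i + j) = k - j := by omega
    rw [this] at hα
    obtain ⟨q, hq, _⟩ := exists_toFinset_eq_glue D (by omega) (by omega) hα p
    exact ⟨q, hq⟩

/-- Whatever decomposition the choice in `signExp` returns, it builds a word with the same index set
as `p`; by injectivity this word is `p`, so the sign does not depend on the choice. -/
theorem signExp_toFinset {k D : ℕ} (p : KLPath k D) (hD : k < D) :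
    signExp k p.toFinset = p.signLength := by
  induction k using Nat.strong_induction_on generalizing D with
  | _ k ih =>
  rw [signExp]
  split_ifs with hA h
  · obtain ⟨q, hq, hs⟩ := exists_toFinset_eq_of_mem_indexA p.pos D hA
    rw [← hs, toFinset_injective hD hq]
  · obtain ⟨⟨h1, h2, h3, h4⟩, hα, hβ, hp⟩ := h.choose_spec
    set s := h.choose.1
    set i := h.choose.2.1
    set α := h.choose.2.2.1
    set β := h.choose.2.2.2
    obtain ⟨j, hj⟩ := Nat.exists_eq_add_of_le (show (i : ℕ) ≤ s by omega)
    obtain ⟨p', hp'⟩ := exists_toFinset_eq (by omega) j hβ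
    have : k + i - s = k - j := by omega
    rw [this] at hα
    obtain ⟨q, hq, hs⟩ := exists_toFinset_eq_glue D (by omega) (by omega) hα p'
    rw [← hp', ih i i.2 p' (by omega), ← hs]
    rw [hp', ← hj, ← hp] at hq
    rw [toFinset_injective hD hq]
  · exfalso
    rcases mem_indexS.1 p.toFinset_mem_indexS with h' | ⟨s, i, α, β, h1, h2, h3, h4⟩
    · exact hA h'
    · exact h ⟨⟨s, i, α, β⟩, h1, h2, h3, h4⟩

/-- Summation over `indexS k` as a sum over words. -/
theorem sum_indexS {k D : ℕ} (hk : 0 < k) (hD : k < D) (g : Finset ℤ[X] → ℤ) :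
    ∑ I ∈ indexS k, g I = ∑ p : KLPath k D, g p.toFinset :=
  (Finset.sum_nbij toFinset (fun p _ => p.toFinset_mem_indexS)
    ((toFinset_injective hD).injOn) (fun _ hI =>
      (exists_toFinset_eq hk D hI).imp fun _ hp => ⟨Finset.mem_coe.2 (Finset.mem_univ _), hp⟩)
    fun _ _ => rfl).symm

end KLPath

/-! ### The top-heavy partner in terms of words -/

theorem minR_constPart_union (R : ℕ) (l : List ℕ) {l' : List ℕ} (hl : l'.Pairwise (· > ·))
    (hne : l' ≠ []) : minR (constPart R l ∪ varPart l') = l'.getLast hne := by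
  refine IsLeast.csInf_eq ⟨X_sub_C_mem_constPart_union.2 ⟨_, List.getLast_mem hne, rfl⟩, ?_⟩
  intro m hm
  obtain ⟨n, hn, rfl⟩ := X_sub_C_mem_constPart_union.1 hm
  exact_mod_cast getLast_le_of_pairwise hl hne hn

theorem maxInt_constPart (R : ℕ) {l : List ℕ} (hl : l.Pairwise (· > ·)) (hne : l ≠ []) :
    maxInt (constPart R l) = R - l.getLast hne := by
  refine IsGreatest.csSup_eq ⟨mem_constPart.2 ⟨_, List.getLast_mem hne, rfl⟩, ?_⟩
  intro m hm
  obtain ⟨n, hn, h⟩ := mem_constPart.1 hm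
  have := getLast_le_of_pairwise hl hne hn
  have := C_inj.1 h
  omega

theorem constPart_append_singleton_sdiff (R : ℕ) {l : List ℕ} {n : ℕ} (hn : n ∉ l) :
    constPart R (l ++ [n]) \ {C ((R : ℤ) - n)} = constPart R l := by
  have h1 : constPart R (l ++ [n]) = constPart R l ∪ {C ((R : ℤ) - n)} := by
    simp [constPart]
  rw [h1, Finset.union_sdiff_right]
  refine Finset.sdiff_eq_self_of_disjoint (Finset.disjoint_singleton_right.2 ?_)
  rw [mem_constPart]
  rintro ⟨m, hm, h⟩
  have := C_inj.1 h
  obtain rfl : m = n := by omega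
  exact hn hm

theorem constPart_union_sdiff (R : ℕ) (l : List ℕ) {l' : List ℕ} {n : ℕ} (hn : n ∉ l') :
    (constPart R l ∪ varPart (l' ++ [n])) \ {X - C (n : ℤ)} = constPart R l ∪ varPart l' := by
  have h1 : varPart (l' ++ [n]) = varPart l' ∪ {X - C (n : ℤ)} := by
    simp [varPart]
  rw [h1, ← Finset.union_assoc, Finset.union_sdiff_right]
  refine Finset.sdiff_eq_self_of_disjoint (Finset.disjoint_singleton_right.2 ?_)
  rw [X_sub_C_mem_constPart_union]
  rintro ⟨m, hm, h⟩
  obtain rfl : n = m := by omega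
  exact hn hm

namespace KLPath

theorem last_of_tail_eq_nil {k D : ℕ} (p : KLPath k D) (h : p.tail = []) : p.last = D := by
  induction p with
  | halt _ => rfl
  | step _ _ p ih => exact ih h
  | jump _ _ p => simp [tail] at h

/-- A jump is never the last letter, so some `r - n` is left once the last corank is removed; the
second minimum in `d(I)` is therefore attained. -/
theorem tail_eq_append {k D : ℕ} (p : KLPath k D) (h : p.tail ≠ []) :
    ∃ t : List ℕ, t ≠ [] ∧ p.tail = t ++ [p.last] ∧ p.init = p.head ++ t := by
  induction p with
  | halt _ => simp [tail] at h
  | step _ _ p ih =>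
    obtain ⟨t, h1, h2, h3⟩ := ih h
    exact ⟨t, h1, h2, by simp [init, head, h3]⟩
  | jump _ _ p =>
    exact ⟨_, List.cons_ne_nil _ _, congrArg _ p.coranks_eq, rfl⟩

theorem last_notMem_init {k D : ℕ} (p : KLPath k D) (hD : k < D) : p.last ∉ p.init := by
  have := p.pairwise_coranks hD
  rw [coranks_eq, List.pairwise_append] at this
  exact fun h => lt_irrefl _ (this.2.2 _ h _ (List.mem_singleton_self _))

theorem pairwise_init {k D : ℕ} (p : KLPath k D) (hD : k < D) : p.init.Pairwise (· > ·) := by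
  have := p.pairwise_coranks hD
  rw [coranks_eq, List.pairwise_append] at this
  exact this.1

/-- In every case `d(I)` is the gap between the last two coranks, the start `k + D` counting as a
corank. By `getLast_init` this gap is `drop`, so the partner exchanges the last corank for `drop`.
-/
theorem partner_toFinset {k D : ℕ} (p : KLPath k D) (hD : k < D) :
    ∃ l l' : List ℕ, l ++ l' = p.init ++ [p.drop] ∧
      partner k p.toFinset = constPart (k + D) l ∪ varPart l' := by
  have hlast := p.getLast_init
  have hnot := p.last_notMem_init hD
  have hpw := p.pairwise_init hD
  have hsing (n : ℕ) : ({X - C (n : ℤ)} : Finset ℤ[X]) = varPart [n] := by simp [varPart]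
  by_cases h : p.tail = []
  · refine ⟨p.init, [p.drop], rfl, ?_⟩
    have hI : p.toFinset = constPart (k + D) (p.init ++ [D]) := by
      have h1 : p.head = p.init ++ [D] := by
        have := p.coranks_eq
        rwa [coranks, h, List.append_nil, p.last_of_tail_eq_nil h] at this
      rw [toFinset, h, h1]
      simp [varPart]
    rw [p.last_of_tail_eq_nil h] at hlast hnot
    have hC : (C (k : ℤ) : ℤ[X]) = C (((k + D : ℕ) : ℤ) - D) := by simp
    have hA := p.toFinset_mem_indexA h
    have hsd : p.toFinset \ {C (k : ℤ)} = constPart (k + D) p.init := by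
      rw [hI, hC, constPart_append_singleton_sdiff _ hnot]
    have hd : shiftD k p.toFinset = p.drop := by
      rw [shiftD, if_pos hA, hsd]
      split_ifs with h1
      -- For `I = {k}` the word halts at once and the gap is `(k + D) - D = k`.
      · rw [h1, sdiff_self] at hsd
        have h2 : p.init = [] := by
          have := hsd.symm
          simpa [constPart] using this
        simp only [h2, List.getLast_singleton] at hlast
        omega
      · have h2 : p.init ≠ [] := by
          intro h2
          apply h1
          rw [hI, h2, hC]
          simp [constPart]
        rw [List.getLast_cons h2] at hlast
        rw [maxInt_constPart _ hpw h2, hlast]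
        push_cast
        ring
    rw [partner, if_pos hA, hsd, hd, hsing]
  · obtain ⟨t, ht, h1, h2⟩ := p.tail_eq_append h
    refine ⟨p.head, t ++ [p.drop], by rw [h2, List.append_assoc], ?_⟩
    have hA := p.toFinset_notMem_indexA h
    have hpt : p.tail.Pairwise (· > ·) := (List.pairwise_append.1 (p.pairwise_coranks hD)).2.1
    have hm : minR p.toFinset = p.last := by
      rw [toFinset, minR_constPart_union _ _ hpt h]
      simp [h1]
    have hsd : p.toFinset \ {X - C (minR p.toFinset)} = constPart (k + D) p.head ∪ varPart t := by
      rw [hm, toFinset, h1, constPart_union_sdiff]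
      exact fun h3 => hnot (h2 ▸ List.mem_append_right _ h3)
    rw [h2] at hpw
    have hd : shiftD k p.toFinset = p.drop := by
      rw [shiftD, if_neg hA, hsd, hm, minR_constPart_union _ _ (List.pairwise_append.1 hpw).2.1 ht]
      rw [List.getLast_cons (by simp [h2, ht])] at hlast
      simp only [h2, List.getLast_append_of_ne_nil _ ht] at hlast
      rw [hlast]
      push_cast
      ring
    rw [partner, if_neg hA, hsd, hd, hsing, Finset.union_assoc, ← varPart_append]

theorem image_eval_partner {k D : ℕ} (p : KLPath k D) (hD : k < D) :
    (partner k p.toFinset).image (eval ((k + D : ℕ) : ℤ)) =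
      (p.init ++ [p.drop]).toFinset.image fun n : ℕ => ((k + D : ℕ) : ℤ) - n := by
  obtain ⟨l, l', h1, h2⟩ := p.partner_toFinset hD
  rw [h2, image_eval_constPart_union, h1]

end KLPath

/-! ### Whitney numbers as multichain counts -/

section Whitney

set_option linter.unusedSectionVars false

variable {P : Type*} [PartialOrder P] [BoundedOrder P] [LocallyFiniteOrder P] [DecidableEq P]
  [GradeMinOrder ℕ P]

theorem monotone_cons_iff {n : ℕ} {F : P} {y : Fin n → P} :
    Monotone (Fin.cons F y : Fin (n + 1) → P) ↔ (∀ j, F ≤ y j) ∧ Monotone y := by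
  constructor
  · intro h
    exact ⟨fun j => by simpa using h (Fin.zero_le j.succ),
      fun i j hij => by simpa using h (Fin.succ_le_succ_iff.2 hij)⟩
  · rintro ⟨h1, h2⟩ i j hij
    induction i using Fin.cases with
    | zero =>
      induction j using Fin.cases with
      | zero => exact le_rfl
      | succ j => simpa using h1 j
    | succ i =>
      induction j using Fin.cases with
      | zero => exact absurd hij (by simp)
      | succ j => simpa using h2 (Fin.succ_le_succ_iff.1 hij)

/-- The multichains above `a` with prescribed coranks. -/
def Multichain (a : P) (l : List ℕ) : Type _ :=
  {x : Fin l.length → P // Monotone x ∧ (∀ j, a ≤ x j) ∧ ∀ j, intervalRank (x j) ⊤ = l.get j}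

/-- A multichain consists of its first element and of a multichain above it. -/
def multichainConsEquiv (a : P) (n : ℕ) (l : List ℕ) : Multichain a (n :: l) ≃
    (F : {F : P // F ∈ (Finset.Icc a ⊤).filter (fun F => intervalRank F ⊤ = n)}) ×
      Multichain F.1 l where
  toFun x := ⟨⟨x.1 0, Finset.mem_filter.2 ⟨Finset.mem_Icc.2 ⟨x.2.2.1 0, le_top⟩, x.2.2.2 0⟩⟩,
    ⟨fun j => x.1 j.succ, fun _ _ hij => x.2.1 (Fin.succ_le_succ_iff.2 hij),
      fun j => x.2.1 (Fin.zero_le _), fun j => x.2.2.2 j.succ⟩⟩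
  invFun y := ⟨Fin.cons (α := fun _ => P) y.1.1 y.2.1, monotone_cons_iff.2 ⟨y.2.2.2.1, y.2.2.1⟩,
    fun j => by
      have h := (Finset.mem_Icc.1 (Finset.mem_filter.1 y.1.2).1).1
      refine Fin.cases h (fun j => ?_) j
      exact h.trans (y.2.2.2.1 j),
    fun j => by
      refine Fin.cases (Finset.mem_filter.1 y.1.2).2 (fun j => ?_) j
      exact y.2.2.2.2 j⟩
  left_inv x := Subtype.ext (Fin.cons_self_tail (α := fun _ => P) x.1)
  right_inv y := rfl

theorem natCard_multichain [Finite P] (a : P) (l : List ℕ) :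
    (Nat.card (Multichain a l) : ℤ) = chainCount l a := by
  have hfin (a : P) (l : List ℕ) : Finite (Multichain a l) := Subtype.finite
  induction l generalizing a with
  | nil =>
    have : Unique (Multichain a []) :=
      { default := ⟨Fin.elim0, fun i => i.elim0, fun i => i.elim0, fun i => i.elim0⟩
        uniq := fun x => Subtype.ext (funext fun i => i.elim0) }
    simp [chainCount]
  | cons n l ih =>
    rw [Nat.card_congr (multichainConsEquiv a n l), Nat.card_sigma, Nat.cast_sum, chainCount,
      levelSum]
    exact (Fintype.sum_congr _ _ fun F => ih _).trans (Finset.sum_coe_sort _ (chainCount l))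

/-- Only the values of `J` at the rank matter. Decreasing coranks are increasing ranks, so the list
agrees with the increasing enumeration used by `whitneySet`. -/
theorem whitneySet_eq_chainCount [Finite P] {J : Finset ℤ[X]} {l : List ℕ}
    (hl : l.Pairwise (· > ·)) (hle : ∀ n ∈ l, n ≤ grade ℕ (⊤ : P))
    (hJ : J.image (eval (grade ℕ (⊤ : P) : ℤ)) =
      l.toFinset.image fun n : ℕ => (grade ℕ (⊤ : P) : ℤ) - n) :
    (whitneySet P J : ℤ) = chainCount l (⊥ : P) := by
  have hcard : (J.image (eval (grade ℕ (⊤ : P) : ℤ))).card = l.length := by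
    rw [hJ, Finset.card_image_of_injective _ fun m n h => by simpa using h,
      List.toFinset_card_of_nodup hl.nodup]
  -- Generalizing the cardinality lets the index type `Fin n` be changed to `Fin l.length`.
  have hw : ∀ (n : ℕ) (h : (J.image (eval (grade ℕ (⊤ : P) : ℤ))).card = n),
      whitneySet P J = whitney P ((J.image (eval (grade ℕ (⊤ : P) : ℤ))).orderEmbOfFin h) := by
    rintro n rfl
    rfl
  have hf : (fun j : Fin l.length => (grade ℕ (⊤ : P) : ℤ) - l.get j) =
      (J.image (eval (grade ℕ (⊤ : P) : ℤ))).orderEmbOfFin hcard := by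
    refine Finset.orderEmbOfFin_unique hcard (fun j => ?_) fun i j hij => ?_
    · rw [hJ]
      exact Finset.mem_image_of_mem _ (List.mem_toFinset.2 (List.get_mem l j))
    · have := List.pairwise_iff_get.1 hl i j hij
      grind
  rw [hw _ hcard, ← hf, whitney, ← natCard_multichain]
  refine congrArg _ (Nat.card_congr (Equiv.subtypeEquivRight fun x => and_congr_right fun _ => ?_))
  simp only [bot_le, implies_true, true_and]
  refine forall_congr' fun j => ?_
  have h1 := hle _ (List.get_mem l j)
  have h2 : grade ℕ (x j) ≤ grade ℕ (⊤ : P) := grade_mono le_top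
  rw [intervalRank]
  omega

end Whitney

end KLWhitney

/-! ### Assembling the formula -/

theorem mainTheorem1 {P : Type*} [Lattice P] [BoundedOrder P] [Finite P] [LocallyFiniteOrder P]
    [DecidableEq P] [GradeMinOrder ℕ P] (k : ℕ) (hk : 1 ≤ k) (hkr : 2 * k < grade ℕ (⊤ : P)) :
    (KLWhitney.klPolynomial P).coeff k =
      ∑ I ∈ KLWhitney.indexS k, (-1 : ℤ) ^ KLWhitney.signExp k I *
        ((KLWhitney.whitneySet P (KLWhitney.partner k I) : ℤ) - KLWhitney.whitneySet P I) := by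
  -- The complementary exponent is `D = r - k`, and `2 * k < r` becomes `k < D`.
  obtain ⟨D, hr⟩ := Nat.exists_eq_add_of_le (show k ≤ grade ℕ (⊤ : P) by omega)
  have hD : k < D := by omega
  have hbot : KLWhitney.intervalRank (⊥ : P) ⊤ = k + D := by
    rw [KLWhitney.intervalRank, grade_bot, hr]
    rfl
  rw [KLWhitney.klPolynomial, (Classical.choose_spec
    (KLWhitney.existsUnique_isKLFamily (P := P)).exists).coeff_eq_sum_paths hk hD ⊥ hbot,
    KLWhitney.KLPath.sum_indexS hk hD]
  refine Finset.sum_congr rfl fun p _ => ?_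
  have hlt : ∀ n ∈ p.coranks, n < k + D := fun n hn => p.lt_of_mem_coranks hD hn
  rw [p.signExp_toFinset hD,
    KLWhitney.whitneySet_eq_chainCount (p.pairwise_init_drop hD) (fun n hn => ?_)
      (hr ▸ p.image_eval_partner hD),
    KLWhitney.whitneySet_eq_chainCount (p.pairwise_coranks hD) (fun n hn => hr ▸ (hlt n hn).le)
      (hr ▸ p.image_eval_toFinset)]
  rw [hr]
  rcases List.mem_append.1 hn with hn | hn
  · exact (hlt n (p.coranks_eq ▸ List.mem_append_left _ hn)).le
  · rw [List.mem_singleton.1 hn]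
    exact (p.drop_lt hD).le
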